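/- Let $n\ge 2$, $\bar v>0$ and $m\in[0,\bar v]^n$. A direct deterministic mechanism for selling one object to $n$ bidders is a tuple $M=(x_i,t_i)_{i=1}^n$ of measurable functions $x_i:[0,\bar v]^n\to\{0,1\}$ with $\sum_i x_i\le 1$ and $t_i:[0,\bar v]^n\to\mathbb{R}$. Let $\mathcal{M}$ be the set of those mechanisms that are dominant-strategy incentive compatible, i.e. $v_ix_i(v)-t_i(v)\ge v_ix_i(w,v_{-i})-t_i(w,v_{-i})$ for all $i$, $v\in[0,\bar v]^n$ and $w\in[0,\bar v]$, and ex post individually rational, i.e. $v_ix_i(v)-t_i(v)\ge 0$ for all $i$ and $v$. Let $\Delta(m,\bar v)$ be the set of all Borel probability distributions $F$ on $[0,\bar v]^n$ with $\int v_i\,dF=m_i$ for all $i$ (the values may be correlated), and let $$\underline{R}(M)=\inf_{F\in\Delta(m,\bar v)}\int\sum_{i=1}^n t_i(v)\,dF\in[-\infty,\infty)$$ be the revenue guarantee of $M\in\mathcal{M}$. A linear score auction with parameters $\alpha_i\ge 0$, $\beta_i>0$ is a mechanism in $\mathcal{M}$ such that, with the scores $s_i(v_i)=\beta_iv_i-\alpha_i$,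 for all $i$ and $v$: $x_i(v)=1$ if $s_i(v_i)>\max\{\max_{j\ne i}s_j(v_j),0\}$, and $x_i(v)=0$ if $s_i(v_i)<\max\{\max_{j\neq i}s_j(v_j),0\}$ (ties may be resolved in any way). It is corner-hitting if for some $r\in[0,\bar v]^n$ its parameters are $\beta_i=\frac{1}{\bar v-r_i}$, $\alpha_i=\frac{r_i}{\bar v-r_i}$ for $i$ with $r_i<\bar v$, and $\beta_i=1$, $\alpha_i=r_i$ for $i$ with $r_i=\bar v$. Theorem. For every mechanism $M\in\mathcal{M}$ there exists a corner-hitting linear score auction $A$ such that $\underline{R}(A)\ge\underline{R}(M)$. -/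

import Mathlib

open MeasureTheory

noncomputable section

/-- A profile `v ∈ [0, vbar]ⁿ` of the values of the `n` bidders. -/
abbrev ValueProfile (n : ℕ) (vbar : ℝ) : Type := Fin n → Set.Icc (0 : ℝ) vbar

/-- A direct deterministic mechanism: measurable allocation functions `x i` with values in `{0, 1}`
which allocate the object to at most one bidder, and measurable transfers `t i` to the seller. -/
structure DirectMechanism (n : ℕ) (vbar : ℝ) where
  x : Fin n → ValueProfile n vbar → ℝ
  t : Fin n → ValueProfile n vbar → ℝ
  measurable_x : ∀ i, Measurable (x i)
  measurable_t : ∀ i, Measurable (t i)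
  deterministic : ∀ i v, x i v = 0 ∨ x i v = 1
  supply : ∀ v, ∑ i, x i v ≤ 1

namespace DirectMechanism

variable {n : ℕ} {vbar : ℝ}

/-- Dominant-strategy incentive compatibility: whatever the others report, reporting the true
value `v i` is at least as good for bidder `i` as any other report `w`. -/
def IsDSIC (M : DirectMechanism n vbar) : Prop :=
  ∀ (i : Fin n) (v : ValueProfile n vbar) (w : Set.Icc (0 : ℝ) vbar),
    (v i : ℝ) * M.x i (Function.update v i w) - M.t i (Function.update v i w)
      ≤ (v i : ℝ) * M.x i v - M.t i v

/-- Ex post individual rationality: truthful participation never gives a negative payoff. -/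
def IsExPostIR (M : DirectMechanism n vbar) : Prop :=
  ∀ (i : Fin n) (v : ValueProfile n vbar), 0 ≤ (v i : ℝ) * M.x i v - M.t i v

/-- The seller's revenue at a value profile. -/
def totalTransfer (M : DirectMechanism n vbar) (v : ValueProfile n vbar) : ℝ :=
  ∑ i, M.t i v

/-- Expected revenue under the distribution `F`, as the extended real
`∫ (revenue)⁺ dF - ∫ (revenue)⁻ dF`. Under ex post individual rationality the revenue is at most
`vbar`, so that the first term is finite; the second one may be infinite. -/
def expectedRevenue (M : DirectMechanism n vbar) (F : Measure (ValueProfile n vbar)) : EReal :=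
  ((∫⁻ v, ENNReal.ofReal (M.totalTransfer v) ∂F : ENNReal) : EReal)
    - ((∫⁻ v, ENNReal.ofReal (-M.totalTransfer v) ∂F : ENNReal) : EReal)

end DirectMechanism

/-- The Borel probability distributions on `[0, vbar]ⁿ` with the vector of means `m`. -/
def priorsWithMean {n : ℕ} (vbar : ℝ) (m : Fin n → ℝ) : Set (Measure (ValueProfile n vbar)) :=
  {F | IsProbabilityMeasure F ∧ ∀ i, ∫ v, (v i : ℝ) ∂F = m i}

namespace DirectMechanism

variable {n : ℕ} {vbar : ℝ}

/-- The revenue guarantee: the infimum of expected revenue over all distributions with means `m`. -/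
def revenueGuarantee (M : DirectMechanism n vbar) (m : Fin n → ℝ) : EReal :=
  ⨅ F ∈ priorsWithMean vbar m, M.expectedRevenue F

/-- The linear score `β i * v i - α i` of bidder `i`. -/
def linearScore (α β : Fin n → ℝ) (v : ValueProfile n vbar) (i : Fin n) : ℝ :=
  β i * (v i : ℝ) - α i

/-- The score that bidder `i` has to beat: the maximum of `0` and of the scores of all others. -/
def scoreToBeat (α β : Fin n → ℝ) (v : ValueProfile n vbar) (i : Fin n) : ℝ :=
  (Finset.univ.erase i).fold max 0 (linearScore α β v)

/-- `A` is a linear score auction with parameters `α ≥ 0`, `β > 0`. Ties are broken arbitrarily. -/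
structure IsLinearScoreAuction (A : DirectMechanism n vbar) (α β : Fin n → ℝ) : Prop where
  dsic : A.IsDSIC
  ir : A.IsExPostIR
  alpha_nonneg : ∀ i, 0 ≤ α i
  beta_pos : ∀ i, 0 < β i
  wins : ∀ i v, scoreToBeat α β v i < linearScore α β v i → A.x i v = 1
  loses : ∀ i v, linearScore α β v i < scoreToBeat α β v i → A.x i v = 0

/-- `A` is a corner-hitting linear score auction: for some `r ∈ [0, vbar]ⁿ` its scores are
`(v i - r i) / (vbar - r i)` if `r i < vbar`, and `v i - r i` if `r i = vbar`. -/
def IsCornerHittingLSA (A : DirectMechanism n vbar) : Prop :=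
  ∃ r : Fin n → ℝ, (∀ i, r i ∈ Set.Icc 0 vbar) ∧
    A.IsLinearScoreAuction
      (fun i => if r i < vbar then r i / (vbar - r i) else r i)
      (fun i => if r i < vbar then 1 / (vbar - r i) else 1)

end DirectMechanism

end

open MeasureTheory Filter Topology

noncomputable section

/-! The argument is linear duality. If all means lie below `vbar` and the guarantee `R` of `M` is
finite, a supporting hyperplane gives slopes `l` with `R + l·(v - m)` below the revenue of `M`
(`IsExPostIR.exists_affine_le`). Replacing negative slopes by `0` does not lower the value at `m`.
Where this minorant `g` is positive, some bidder `i` wins in `M`. Raising `v i` to `vbar` leaves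
revenue at most `v i` by incentive compatibility, so `g v + l i * (vbar - v i) ≤ v i`, that is, `g v
≤ (1 + l i) * v i - l i * vbar` (`IsDSIC.affine_le_score`). The right side is `vbar` times a linear
score that equals `1` at `v i = vbar`. The auction with these scores has revenue at least `g`
everywhere (`affine_le_revenue_topScoreAuction`), hence guarantee at least `R`. A mean equal to
`vbar` is treated separately, by selling to that bidder at price `vbar`. -/

/-! ### Supporting hyperplanes. -/

/-- A convex set that contains an upper cylinder around `m` and lies above height `R` over `m`
has a non-vertical supporting hyperplane at `(m, R)`. -/
theorem Convex.exists_affine_le {n : ℕ} {C : Set ((Fin n → ℝ) × ℝ)} (hC : Convex ℝ C)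
    {m : Fin n → ℝ} {R B : ℝ} (hB : ∀ᶠ z in 𝓝 m, ∀ y, B ≤ y → (z, y) ∈ C)
    (hR : ∀ y, (m, y) ∈ C → R ≤ y) :
    ∃ l : Fin n → ℝ, ∀ z y, (z, y) ∈ C → R + ∑ i, l i * (z i - m i) ≤ y := by
  have hint : ∀ y, B < y → (m, y) ∈ interior C := by
    intro y hy
    rw [mem_interior_iff_mem_nhds, nhds_prod_eq]
    filter_upwards [hB.prod_mk (lt_mem_nhds hy)] with p hp
    exact hp.1 _ hp.2.le
  have hnot : (m, R) ∉ interior C := by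
    intro h
    rw [mem_interior_iff_mem_nhds] at h
    have hcont : Tendsto (fun y : ℝ => (m, y)) (𝓝 R) (𝓝 (m, R)) :=
      (Continuous.prodMk_right m).tendsto R
    obtain ⟨y, hy, hyR⟩ := ((hcont.eventually h).filter_mono nhdsWithin_le_nhds
      |>.and (self_mem_nhdsWithin : Set.Iio R ∈ 𝓝[<] R)).exists
    exact absurd (hR y hy) (not_le.mpr hyR)
  obtain ⟨f, hf⟩ := geometric_hahn_banach_open_point hC.interior isOpen_interior hnot
  have hsub : ∀ p ∈ C, f p ≤ f (m, R) := by
    intro p hp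
    have hp' : p ∈ closure (interior C) := by
      rw [hC.closure_interior_eq_closure_of_nonempty_interior
        ⟨_, hint (B + 1) (by linarith)⟩]
      exact subset_closure hp
    exact closure_minimal (fun q hq => (hf q hq).le)
      (isClosed_le f.continuous continuous_const) hp'
  set k : ℝ := f (0, 1) with hk
  set a : Fin n → ℝ := fun i => f (Pi.single i 1, 0) with ha
  have hfp : ∀ z y, f (z, y) = ∑ i, z i * a i + y * k := by
    intro z y
    have h1 : ((z, y) : (Fin n → ℝ) × ℝ)
        = ∑ i, z i • ((Pi.single i 1 : Fin n → ℝ), (0 : ℝ)) + y • ((0 : Fin n → ℝ), (1 : ℝ)) := by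
      ext j
      · simp [Prod.fst_sum, Finset.sum_apply, Pi.single_apply]
      · simp [Prod.snd_sum]
    rw [h1, map_add, map_sum]
    simp only [map_smul, smul_eq_mul, ha, hk]
  -- Comparing `(m, R)` with an interior point directly above it shows that the hyperplane is not
  -- vertical.
  have hkneg : k < 0 := by
    have h := hf _ (hint (max (B + 1) (R + 1)) (by linarith [le_max_left (B + 1) (R + 1)]))
    rw [hfp, hfp] at h
    have h2 : R + 1 ≤ max (B + 1) (R + 1) := le_max_right _ _
    nlinarith
  refine ⟨fun i => a i / (-k), fun z y hzy => ?_⟩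
  have h := hsub _ hzy
  rw [hfp, hfp] at h
  have h3 : ∑ i, a i / (-k) * (z i - m i) = (∑ i, z i * a i - ∑ i, m i * a i) / (-k) := by
    rw [← Finset.sum_sub_distrib, Finset.sum_div]
    exact Finset.sum_congr rfl fun i _ => by ring
  rw [h3]
  have h4 : (∑ i, z i * a i - ∑ i, m i * a i) / (-k) ≤ y - R := by
    rw [div_le_iff₀ (by linarith)]
    linarith
  linarith

namespace DirectMechanism

variable {n : ℕ} {vbar : ℝ}

/-! ### Revenue bounds from incentive compatibility and individual rationality. -/

theorem measurable_totalTransfer (M : DirectMechanism n vbar) : Measurable M.totalTransfer :=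
  Finset.measurable_fun_sum _ fun i _ => M.measurable_t i

theorem expectedRevenue_eq_integral (M : DirectMechanism n vbar)
    {F : Measure (ValueProfile n vbar)} (h : Integrable M.totalTransfer F) :
    M.expectedRevenue F = ((∫ v, M.totalTransfer v ∂F : ℝ) : EReal) := by
  have hneg : ∫⁻ v, ENNReal.ofReal (-M.totalTransfer v) ∂F ≠ ⊤ := h.neg.lintegral_lt_top.ne
  rw [integral_eq_lintegral_pos_part_sub_lintegral_neg_part h, expectedRevenue, EReal.coe_sub,
    EReal.coe_ennreal_toReal h.lintegral_lt_top.ne,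
    EReal.coe_ennreal_toReal hneg]

theorem measurable_value (i : Fin n) : Measurable fun v : ValueProfile n vbar => (v i : ℝ) :=
  measurable_subtype_coe.comp (measurable_pi_apply i)

theorem integrable_value (F : Measure (ValueProfile n vbar)) [IsFiniteMeasure F] (i : Fin n) :
    Integrable (fun v : ValueProfile n vbar => (v i : ℝ)) F := by
  refine Integrable.of_bound (C := vbar)
    (measurable_value i).aestronglyMeasurable
    (ae_of_all _ fun v => ?_)
  rw [Real.norm_eq_abs, abs_of_nonneg (v i).2.1]
  exact (v i).2.2

theorem x_eq_zero_of_winner (M : DirectMechanism n vbar) {i j : Fin n} (hij : j ≠ i)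
    {v : ValueProfile n vbar} (h : M.x i v = 1) : M.x j v = 0 := by
  rcases M.deterministic j v with h0 | h1
  · exact h0
  · have hle : M.x i v + M.x j v ≤ ∑ k, M.x k v := by
      rw [← Finset.sum_pair (f := fun k => M.x k v) hij.symm]
      refine Finset.sum_le_sum_of_subset_of_nonneg (Finset.subset_univ _) fun k _ _ => ?_
      rcases M.deterministic k v with h | h <;> simp [h]
    linarith [M.supply v]

theorem IsExPostIR.t_nonpos {M : DirectMechanism n vbar} (hM : M.IsExPostIR) {i : Fin n}
    {v : ValueProfile n vbar} (h : M.x i v = 0) : M.t i v ≤ 0 := by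
  have := hM i v
  rw [h] at this
  linarith

theorem IsExPostIR.totalTransfer_le_winner {M : DirectMechanism n vbar} (hM : M.IsExPostIR)
    {i : Fin n} {v : ValueProfile n vbar} (h : M.x i v = 1) : M.totalTransfer v ≤ M.t i v := by
  rw [totalTransfer, ← Finset.add_sum_erase _ _ (Finset.mem_univ i)]
  have : ∑ j ∈ Finset.univ.erase i, M.t j v ≤ 0 := Finset.sum_nonpos fun j hj =>
    hM.t_nonpos (M.x_eq_zero_of_winner (Finset.ne_of_mem_erase hj) h)
  linarith

theorem IsExPostIR.exists_winner {M : DirectMechanism n vbar} (hM : M.IsExPostIR)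
    {v : ValueProfile n vbar} (h : 0 < M.totalTransfer v) : ∃ i, M.x i v = 1 := by
  by_contra! hne
  exact absurd h (not_lt.mpr (Finset.sum_nonpos fun i _ =>
    hM.t_nonpos ((M.deterministic i v).resolve_right (hne i))))

theorem IsExPostIR.t_le_value {M : DirectMechanism n vbar} (hM : M.IsExPostIR)
    {i : Fin n} {v : ValueProfile n vbar} (h : M.x i v = 1) : M.t i v ≤ v i := by
  have := hM i v
  rw [h] at this
  linarith

theorem IsExPostIR.totalTransfer_le {M : DirectMechanism n vbar} (hM : M.IsExPostIR)
    (hv : 0 ≤ vbar) (v : ValueProfile n vbar) : M.totalTransfer v ≤ vbar := by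
  by_cases h : 0 < M.totalTransfer v
  · obtain ⟨i, hi⟩ := hM.exists_winner h
    exact (hM.totalTransfer_le_winner hi).trans ((hM.t_le_value hi).trans (v i).2.2)
  · exact (not_lt.mp h).trans hv

theorem IsExPostIR.expectedRevenue_le {M : DirectMechanism n vbar} (hM : M.IsExPostIR)
    (hv : 0 ≤ vbar) (F : Measure (ValueProfile n vbar)) [IsProbabilityMeasure F] :
    M.expectedRevenue F ≤ vbar := by
  have h : ∫⁻ v, ENNReal.ofReal (M.totalTransfer v) ∂F ≤ ENNReal.ofReal vbar := by
    calc _ ≤ ∫⁻ _, ENNReal.ofReal vbar ∂F :=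
          lintegral_mono fun v => ENNReal.ofReal_le_ofReal (hM.totalTransfer_le hv v)
      _ = _ := by simp
  calc M.expectedRevenue F
      ≤ ((∫⁻ v, ENNReal.ofReal (M.totalTransfer v) ∂F : ENNReal) : EReal) - 0 :=
        EReal.sub_le_sub le_rfl (EReal.coe_ennreal_nonneg _)
    _ ≤ ((ENNReal.ofReal vbar : ENNReal) : EReal) := by
        rw [sub_zero]; exact EReal.coe_ennreal_le_coe_ennreal_iff.mpr h
    _ = vbar := by rw [EReal.coe_ennreal_ofReal, max_eq_left hv]

/-- A winner keeps winning at the highest value, at a price below the former value. -/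
theorem IsDSIC.totalTransfer_update_top_le {M : DirectMechanism n vbar} (hM : M.IsDSIC)
    (hir : M.IsExPostIR) {i : Fin n} {v : ValueProfile n vbar} (h : M.x i v = 1)
    (w : Set.Icc (0 : ℝ) vbar) (hw : v i ≤ w) :
    M.totalTransfer (Function.update v i w) ≤ v i := by
  rcases hw.eq_or_lt with heq | hlt
  · rw [← heq, Function.update_eq_self]
    exact (hir.totalTransfer_le_winner h).trans (hir.t_le_value h)
  · have h1 := hM i v w
    have h2 := hM i (Function.update v i w) (v i)
    rw [Function.update_idem, Function.update_eq_self, Function.update_self] at h2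
    have hlt' : (v i : ℝ) < w := hlt
    have hwin : M.x i (Function.update v i w) = 1 := by
      refine (M.deterministic i _).resolve_left fun h0 => ?_
      rw [h0, h] at h1 h2
      linarith
    have h3 := hir.totalTransfer_le_winner hwin
    have h4 := hir.t_le_value h
    -- The type `w` could report `v i` and win at the old price, so its own price is no higher.
    rw [hwin, h] at h2
    linarith

/-! ### Construction of linear score auctions. -/

theorem scoreToBeat_nonneg (α β : Fin n → ℝ) (v : ValueProfile n vbar) (i : Fin n) :
    0 ≤ scoreToBeat α β v i :=
  Finset.le_fold_max 0 |>.mpr (Or.inl le_rfl)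

theorem le_scoreToBeat (α β : Fin n → ℝ) (v : ValueProfile n vbar) {i j : Fin n} (h : j ≠ i) :
    linearScore α β v j ≤ scoreToBeat α β v i :=
  Finset.le_fold_max _ |>.mpr (Or.inr ⟨j, by simp [h], le_rfl⟩)

theorem scoreToBeat_le {α β : Fin n → ℝ} {v : ValueProfile n vbar} {i : Fin n} {c : ℝ}
    (h0 : 0 ≤ c) (h : ∀ j, j ≠ i → linearScore α β v j ≤ c) : scoreToBeat α β v i ≤ c :=
  Finset.fold_max_le _ |>.mpr ⟨h0, fun j hj => h j (Finset.ne_of_mem_erase hj)⟩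

theorem scoreToBeat_update (α β : Fin n → ℝ) (v : ValueProfile n vbar) (i : Fin n)
    (w : Set.Icc (0 : ℝ) vbar) :
    scoreToBeat α β (Function.update v i w) i = scoreToBeat α β v i := by
  refine Finset.fold_congr fun j hj => ?_
  rw [linearScore, Function.update_of_ne (Finset.ne_of_mem_erase hj), linearScore]

theorem measurable_linearScore (α β : Fin n → ℝ) (i : Fin n) :
    Measurable fun v : ValueProfile n vbar => linearScore α β v i :=
  ((measurable_value i).const_mul _).sub_const _

theorem measurable_scoreToBeat (α β : Fin n → ℝ) (i : Fin n) :
    Measurable fun v : ValueProfile n vbar => scoreToBeat α β v i := by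
  unfold scoreToBeat
  induction Finset.univ.erase i using Finset.induction_on with
  | empty => simp
  | insert j s hj ih =>
    simp only [Finset.fold_insert hj]
    exact (measurable_linearScore α β j).max ih

/-- The mechanism with a given allocation in which a winner pays the value at which his score
equals the score to beat. -/
def ofScores (α β : Fin n → ℝ) (x : Fin n → ValueProfile n vbar → ℝ)
    (hmeas : ∀ i, Measurable (x i)) (hdet : ∀ i v, x i v = 0 ∨ x i v = 1)
    (hsupply : ∀ v, ∑ i, x i v ≤ 1) : DirectMechanism n vbar where
  x := x
  t i v := x i v * ((scoreToBeat α β v i + α i) / β i)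
  measurable_x := hmeas
  measurable_t i := (hmeas i).mul (((measurable_scoreToBeat α β i).add_const _).div_const _)
  deterministic := hdet
  supply := hsupply

/-- The price is independent of the own report, and at a tie it equals the value. The payoff is
therefore the positive part of value minus price, however ties are resolved. -/
theorem isLinearScoreAuction_ofScores {α β : Fin n → ℝ} {x : Fin n → ValueProfile n vbar → ℝ}
    (hmeas : ∀ i, Measurable (x i)) (hdet : ∀ i v, x i v = 0 ∨ x i v = 1)
    (hsupply : ∀ v, ∑ i, x i v ≤ 1) (hα : ∀ i, 0 ≤ α i) (hβ : ∀ i, 0 < β i)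
    (hwins : ∀ i v, scoreToBeat α β v i < linearScore α β v i → x i v = 1)
    (hloses : ∀ i v, linearScore α β v i < scoreToBeat α β v i → x i v = 0) :
    (ofScores α β x hmeas hdet hsupply).IsLinearScoreAuction α β := by
  have hpay : ∀ (i : Fin n) (v : ValueProfile n vbar),
      (v i : ℝ) - (scoreToBeat α β v i + α i) / β i
        = (linearScore α β v i - scoreToBeat α β v i) / β i := by
    intro i v
    have := (hβ i).ne'
    rw [linearScore]
    field_simp
    ring
  have hutil : ∀ (i : Fin n) (v : ValueProfile n vbar),
      (v i : ℝ) * x i v - x i v * ((scoreToBeat α β v i + α i) / β i)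
        = max 0 ((v i : ℝ) - (scoreToBeat α β v i + α i) / β i) := by
    intro i v
    have hfac : (v i : ℝ) * x i v - x i v * ((scoreToBeat α β v i + α i) / β i)
      = x i v * ((v i : ℝ) - (scoreToBeat α β v i + α i) / β i) := by ring
    rw [hfac, hpay]
    rcases lt_trichotomy (linearScore α β v i) (scoreToBeat α β v i) with h | h | h
    · rw [hloses i v h, zero_mul, max_eq_left]
      exact div_nonpos_of_nonpos_of_nonneg (by linarith) (hβ i).le
    · simp [h]
    · rw [hwins i v h, one_mul, max_eq_right]
      exact div_nonneg (by linarith) (hβ i).le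
  refine ⟨fun i v w => ?_, fun i v => ?_, hα, hβ, hwins, hloses⟩
  · change (v i : ℝ) * x i _ - x i _ * ((scoreToBeat α β _ i + α i) / β i)
      ≤ (v i : ℝ) * x i v - x i v * ((scoreToBeat α β v i + α i) / β i)
    rw [hutil, scoreToBeat_update]
    rcases hdet i (Function.update v i w) with h | h <;> rw [h]
    · simp
    · simp
  · change 0 ≤ (v i : ℝ) * x i v - x i v * ((scoreToBeat α β v i + α i) / β i)
    rw [hutil]
    exact le_max_left _ _

/-- The bidders with the highest nonnegative score. -/
def IsTop (α β : Fin n → ℝ) (v : ValueProfile n vbar) (i : Fin n) : Prop :=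
  scoreToBeat α β v i ≤ linearScore α β v i

/-- The allocation to the bidder with the highest nonnegative score, ties being broken in favour of
the lowest index. -/
def topAllocation (α β : Fin n → ℝ) (i : Fin n) (v : ValueProfile n vbar) : ℝ :=
  open Classical in if IsTop α β v i ∧ ∀ j < i, ¬ IsTop α β v j then 1 else 0

theorem measurable_topAllocation (α β : Fin n → ℝ) (i : Fin n) :
    Measurable (topAllocation (vbar := vbar) α β i) := by
  have hset : ∀ j : Fin n, MeasurableSet {v : ValueProfile n vbar | IsTop α β v j} := fun j =>
    measurableSet_le (measurable_scoreToBeat α β j) (measurable_linearScore α β j)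
  refine Measurable.ite ?_ measurable_const measurable_const
  refine (hset i).inter ?_
  have heq : {v : ValueProfile n vbar | ∀ j < i, ¬ IsTop α β v j}
      = ⋂ j, ⋂ _ : j < i, {v | IsTop α β v j}ᶜ := by
    ext v
    simp
  change MeasurableSet {v : ValueProfile n vbar | ∀ j < i, ¬ IsTop α β v j}
  rw [heq]
  exact MeasurableSet.iInter fun j => MeasurableSet.iInter fun _ => (hset j).compl

theorem topAllocation_eq_zero_or_one (α β : Fin n → ℝ) (i : Fin n) (v : ValueProfile n vbar) :
    topAllocation α β i v = 0 ∨ topAllocation α β i v = 1 := by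
  unfold topAllocation
  split_ifs <;> simp

theorem sum_topAllocation_le (α β : Fin n → ℝ) (v : ValueProfile n vbar) :
    ∑ i, topAllocation α β i v ≤ 1 := by
  classical
  unfold topAllocation
  rw [Finset.sum_boole]
  have : (Finset.univ.filter fun i => IsTop α β v i ∧ ∀ j < i, ¬ IsTop α β v j).card ≤ 1 := by
    refine Finset.card_le_one.mpr fun a ha b hb => ?_
    simp only [Finset.mem_filter, Finset.mem_univ, true_and] at ha hb
    rcases lt_trichotomy a b with h | h | h
    · exact absurd ha.1 (hb.2 a h)
    · exact h
    · exact absurd hb.1 (ha.2 b h)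
  exact_mod_cast this

theorem topAllocation_eq_one {α β : Fin n → ℝ} {i : Fin n} {v : ValueProfile n vbar}
    (h : scoreToBeat α β v i < linearScore α β v i) : topAllocation α β i v = 1 := by
  refine if_pos ⟨h.le, fun j hj hj' => ?_⟩
  have h1 := le_scoreToBeat α β v hj.ne'
  have h2 := le_scoreToBeat α β v hj.ne
  unfold IsTop at hj'
  linarith

theorem topAllocation_eq_zero {α β : Fin n → ℝ} {i : Fin n} {v : ValueProfile n vbar}
    (h : linearScore α β v i < scoreToBeat α β v i) : topAllocation α β i v = 0 :=
  if_neg fun h' => absurd h'.1 (not_le.mpr h)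

theorem isTop_of_topAllocation {α β : Fin n → ℝ} {i : Fin n} {v : ValueProfile n vbar}
    (h : topAllocation α β i v = 1) : IsTop α β v i := by
  by_contra hne
  rw [topAllocation_eq_zero (not_le.mp hne)] at h
  exact zero_ne_one h

theorem exists_topAllocation {α β : Fin n → ℝ} {i : Fin n} {v : ValueProfile n vbar}
    (h : 0 ≤ linearScore α β v i) : ∃ j, topAllocation α β j v = 1 := by
  classical
  obtain ⟨k, -, hk⟩ := Finset.exists_max_image Finset.univ (linearScore α β v) ⟨i, by simp⟩
  have htop : IsTop α β v k := scoreToBeat_le (h.trans (hk i (by simp))) fun j _ => hk j (by simp)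
  have hne : (Finset.univ.filter fun j => IsTop α β v j).Nonempty := ⟨k, by simp [htop]⟩
  refine ⟨_, if_pos ⟨(Finset.mem_filter.mp (Finset.min'_mem _ hne)).2, fun j hj hj' => ?_⟩⟩
  exact absurd (Finset.min'_le _ j (by simp [hj'])) (not_le.mpr hj)

/-- The linear score auction with ties broken in favour of the lowest index. -/
def topScoreAuction (α β : Fin n → ℝ) : DirectMechanism n vbar :=
  ofScores α β (topAllocation α β) (measurable_topAllocation α β)
    (topAllocation_eq_zero_or_one α β) (sum_topAllocation_le α β)

/-! ### Score auctions built from the slopes of an affine function. -/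

/-- If an increasing affine function is everywhere at most `0` or at most the score, built from
its slopes, of some bidder, then it bounds the revenue of the score auction from below. -/
theorem affine_le_revenue_topScoreAuction (hv : 0 < vbar) {c : ℝ} {l : Fin n → ℝ} (hl : ∀ i, 0 ≤ l i)
    (hkey : ∀ v : ValueProfile n vbar, c + ∑ i, l i * (v i : ℝ) ≤ 0 ∨
      ∃ i, c + ∑ i, l i * (v i : ℝ) ≤ (1 + l i) * (v i : ℝ) - l i * vbar)
    (v : ValueProfile n vbar) :
    c + ∑ i, l i * (v i : ℝ) ≤
      (topScoreAuction l fun i => (1 + l i) / vbar).totalTransfer v := by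
  set β : Fin n → ℝ := fun i => (1 + l i) / vbar with hβ
  have hβpos : ∀ i, 0 < β i := fun i => div_pos (by linarith [hl i]) hv
  have hscore : ∀ (v : ValueProfile n vbar) i,
      (1 + l i) * (v i : ℝ) - l i * vbar = vbar * linearScore l β v i := by
    intro v i
    simp only [linearScore, hβ]
    field_simp
  have hpos : ∀ (i : Fin n) (v : ValueProfile n vbar),
      0 ≤ topAllocation l β i v * ((scoreToBeat l β v i + l i) / β i) := fun i v =>
    mul_nonneg (by rcases topAllocation_eq_zero_or_one l β i v with h | h <;> simp [h])
      (div_nonneg (add_nonneg (scoreToBeat_nonneg _ _ _ _) (hl i)) (hβpos i).le)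
  change _ ≤ ∑ i, topAllocation l β i v * ((scoreToBeat l β v i + l i) / β i)
  by_cases hle : c + ∑ i, l i * (v i : ℝ) ≤ 0
  · exact hle.trans (Finset.sum_nonneg fun i _ => hpos i v)
  obtain ⟨k, hk⟩ := (hkey v).resolve_left hle
  have hk0 : 0 ≤ linearScore l β v k := by
    rw [hscore] at hk
    exact (pos_of_mul_pos_right ((not_le.mp hle).trans_le hk) hv.le).le
  obtain ⟨i, hi⟩ := exists_topAllocation hk0
  have htop : scoreToBeat l β v i ≤ linearScore l β v i := isTop_of_topAllocation hi
  have hS := scoreToBeat_nonneg l β v i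
  refine le_trans ?_ (Finset.single_le_sum (fun j _ => hpos j v) (Finset.mem_univ i))
  rw [hi, one_mul]
  set p : ℝ := (scoreToBeat l β v i + l i) / β i with hp
  have hβp : β i * p = scoreToBeat l β v i + l i := mul_div_cancel₀ _ (hβpos i).ne'
  have hp0 : 0 ≤ p := div_nonneg (add_nonneg hS (hl i)) (hβpos i).le
  have hpv : p ≤ v i := by
    rw [hp, div_le_iff₀ (hβpos i)]
    rw [linearScore] at htop
    linarith
  have hpb : p ≤ vbar := hpv.trans (v i).2.2
  -- Lower the winner's value to his price: his score falls to the score to beat, which then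
  -- dominates all scores, so `hkey` bounds the affine function at `v'`.
  set v' : ValueProfile n vbar := Function.update v i ⟨p, hp0, hpb⟩ with hv'
  have hsi : linearScore l β v' i = scoreToBeat l β v i := by
    rw [linearScore, hv', Function.update_self, hβp]
    ring
  have hbound : c + ∑ j, l j * (v' j : ℝ) ≤ vbar * scoreToBeat l β v i := by
    rcases hkey v' with h | ⟨j, h⟩
    · exact h.trans (mul_nonneg hv.le hS)
    · rw [hscore] at h
      refine h.trans (mul_le_mul_of_nonneg_left ?_ hv.le)
      rcases eq_or_ne j i with rfl | hji
      · exact hsi.le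
      · rw [← scoreToBeat_update l β v i ⟨p, hp0, hpb⟩]
        exact le_scoreToBeat l β v' hji
  have hsum : ∑ j, l j * (v j : ℝ) - ∑ j, l j * (v' j : ℝ) = l i * ((v i : ℝ) - p) := by
    rw [← Finset.sum_sub_distrib, Finset.sum_eq_single i]
    · rw [hv', Function.update_self]; ring
    · intro j _ hj
      rw [hv', Function.update_of_ne hj, sub_self]
    · simp
  have h1 := hscore v' i
  rw [hsi] at h1
  have h2 : ((v' i : Set.Icc (0 : ℝ) vbar) : ℝ) = p := by rw [hv', Function.update_self]
  rw [h2] at h1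
  -- Moving back from `v'` to `v` adds `l i * (v i - p)`, for a total of at most `p - l i * (vbar -
  -- v i) ≤ p`.
  have h3 : l i * (v i : ℝ) ≤ l i * vbar := mul_le_mul_of_nonneg_left (v i).2.2 (hl i)
  linarith

/-- The score vanishes at `r i = l i * vbar / (1 + l i)`, where `vbar - r i = vbar / (1 + l i)`. -/
theorem isCornerHittingLSA_topScoreAuction (hv : 0 < vbar) {l : Fin n → ℝ} (hl : ∀ i, 0 ≤ l i) :
    (topScoreAuction (vbar := vbar) l fun i => (1 + l i) / vbar).IsCornerHittingLSA := by
  have hr : ∀ i, l i * vbar / (1 + l i) < vbar := fun i => by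
    rw [div_lt_iff₀ (by linarith [hl i])]
    linarith
  refine ⟨fun i => l i * vbar / (1 + l i), fun i => ⟨?_, (hr i).le⟩, ?_⟩
  · exact div_nonneg (mul_nonneg (hl i) hv.le) (by linarith [hl i])
  have hsub : ∀ i, vbar - l i * vbar / (1 + l i) = vbar / (1 + l i) := fun i => by
    have : 1 + l i ≠ 0 := by linarith [hl i]
    field_simp
    ring
  have hα : (fun i => if l i * vbar / (1 + l i) < vbar then
      l i * vbar / (1 + l i) / (vbar - l i * vbar / (1 + l i)) else l i * vbar / (1 + l i)) = l := by
    funext i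
    have : 1 + l i ≠ 0 := by linarith [hl i]
    rw [if_pos (hr i), hsub]
    field_simp
  have hβ : (fun i => if l i * vbar / (1 + l i) < vbar then
      1 / (vbar - l i * vbar / (1 + l i)) else 1) = fun i => (1 + l i) / vbar := by
    funext i
    rw [if_pos (hr i), hsub, one_div_div]
  rw [hα, hβ]
  exact isLinearScoreAuction_ofScores _ _ _ hl (fun i => div_pos (by linarith [hl i]) hv)
    (fun _ _ => topAllocation_eq_one) (fun _ _ => topAllocation_eq_zero)

/-! ### Duality between the guarantee and affine minorants. -/

theorem integral_affine {F : Measure (ValueProfile n vbar)} {m : Fin n → ℝ}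
    (hF : F ∈ priorsWithMean vbar m) (c : ℝ) (l : Fin n → ℝ) :
    Integrable (fun v : ValueProfile n vbar => c + ∑ i, l i * (v i : ℝ)) F ∧
      ∫ v : ValueProfile n vbar, (c + ∑ i, l i * (v i : ℝ)) ∂F = c + ∑ i, l i * m i := by
  obtain ⟨_, hmean⟩ := hF
  have hint : ∀ i ∈ Finset.univ, Integrable (fun v : ValueProfile n vbar => l i * (v i : ℝ)) F :=
    fun i _ => (integrable_value F i).const_mul _
  have hsum := integrable_finsetSum _ hint
  refine ⟨(integrable_const c).add hsum, ?_⟩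
  rw [integral_add (integrable_const c) hsum, integral_finsetSum _ hint]
  simp [integral_const_mul, hmean]

/-- An increasing affine minorant of the revenue bounds the revenue guarantee from below. -/
theorem le_revenueGuarantee_of_affine_le {A : DirectMechanism n vbar} (hv : 0 ≤ vbar)
    (hA : A.IsExPostIR) {m : Fin n → ℝ} {c : ℝ} {l : Fin n → ℝ} (hl : ∀ i, 0 ≤ l i)
    (h : ∀ v : ValueProfile n vbar, c + ∑ i, l i * (v i : ℝ) ≤ A.totalTransfer v) :
    ((c + ∑ i, l i * m i : ℝ) : EReal) ≤ A.revenueGuarantee m := by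
  refine le_iInf₂ fun F hF => ?_
  obtain ⟨hint, heq⟩ := integral_affine hF c l
  have := hF.1
  -- Nonnegative slopes bound the revenue below by `c`, so it is integrable under every prior.
  have hbd : ∀ v : ValueProfile n vbar, c ≤ A.totalTransfer v := fun v =>
    le_trans (le_add_of_nonneg_right
      (Finset.sum_nonneg fun i _ => mul_nonneg (hl i) (v i).2.1)) (h v)
  have hgint : Integrable A.totalTransfer F := by
    refine Integrable.of_mem_Icc c vbar A.measurable_totalTransfer.aemeasurable
      (ae_of_all _ fun v => ⟨hbd v, hA.totalTransfer_le hv v⟩)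
  rw [expectedRevenue_eq_integral A hgint, ← heq]
  exact EReal.coe_le_coe_iff.mpr (integral_mono hint hgint h)

/-- The attainable pairs of mean values and upper bounds on expected revenue, the means outside
`s` being fixed to `0`. -/
def revenueEpigraph (M : DirectMechanism n vbar) (s : Set (Fin n)) : Set ((Fin n → ℝ) × ℝ) :=
  {p | ∃ F : Measure (ValueProfile n vbar), F ∈ priorsWithMean vbar (s.indicator p.1) ∧
    Integrable M.totalTransfer F ∧ ∫ v, M.totalTransfer v ∂F ≤ p.2}

/-- Means and expected revenue are affine under mixing of priors. -/
theorem convex_revenueEpigraph (M : DirectMechanism n vbar) (s : Set (Fin n)) :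
    Convex ℝ (M.revenueEpigraph s) := by
  rintro ⟨z, y⟩ ⟨F, ⟨hFp, hFm⟩, hFi, hFy⟩ ⟨z', y'⟩ ⟨G, ⟨hGp, hGm⟩, hGi, hGy⟩ a b ha hb hab
  have htop : ENNReal.ofReal a ≠ ⊤ := ENNReal.ofReal_ne_top
  have htop' : ENNReal.ofReal b ≠ ⊤ := ENNReal.ofReal_ne_top
  have hcomb : ∀ f : ValueProfile n vbar → ℝ, Integrable f F → Integrable f G →
      ∫ v, f v ∂(ENNReal.ofReal a • F + ENNReal.ofReal b • G)
        = a * ∫ v, f v ∂F + b * ∫ v, f v ∂G := by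
    intro f hf hg
    rw [integral_add_measure (hf.smul_measure htop) (hg.smul_measure htop'),
      integral_smul_measure, integral_smul_measure, ENNReal.toReal_ofReal ha,
      ENNReal.toReal_ofReal hb, smul_eq_mul, smul_eq_mul]
  refine ⟨ENNReal.ofReal a • F + ENNReal.ofReal b • G, ⟨⟨?_⟩, fun i => ?_⟩,
    (hFi.smul_measure htop).add_measure (hGi.smul_measure htop'), ?_⟩
  · simp only [Measure.coe_add, Measure.coe_smul, Pi.add_apply, Pi.smul_apply, measure_univ,
      smul_eq_mul, mul_one]
    rw [← ENNReal.ofReal_add ha hb, hab, ENNReal.ofReal_one]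
  · rw [hcomb _ (integrable_value F i) (integrable_value G i), hFm, hGm]
    by_cases hi : i ∈ s <;> simp [hi]
  · rw [hcomb _ hFi hGi]
    exact add_le_add (mul_le_mul_of_nonneg_left hFy ha) (mul_le_mul_of_nonneg_left hGy hb)

theorem mem_revenueEpigraph (M : DirectMechanism n vbar) {s : Set (Fin n)} {z : Fin n → ℝ}
    {y : ℝ} (v : ValueProfile n vbar) (hz : ∀ i, (v i : ℝ) = s.indicator z i)
    (hy : M.totalTransfer v ≤ y) : (z, y) ∈ M.revenueEpigraph s := by
  have hm : StronglyMeasurable M.totalTransfer := M.measurable_totalTransfer.stronglyMeasurable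
  refine ⟨Measure.dirac v, ⟨inferInstance, fun i => ?_⟩, integrable_dirac' hm (by simp), ?_⟩
  · rw [integral_dirac' _ _ (measurable_value i).stronglyMeasurable]
    exact hz i
  · rw [integral_dirac' _ _ hm]
    exact hy

/-- At means below `vbar`, the revenue guarantee is supported by an affine minorant of the revenue
on the profiles where bidders of mean `0` have value `0`. -/
theorem IsExPostIR.exists_affine_le {M : DirectMechanism n vbar} (hM : M.IsExPostIR)
    {m : Fin n → ℝ} (hm : ∀ i, m i ∈ Set.Ico 0 vbar) (hv : 0 ≤ vbar) {R : ℝ}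
    (hR : (R : EReal) ≤ M.revenueGuarantee m) :
    ∃ l : Fin n → ℝ, ∀ v : ValueProfile n vbar, (∀ i, m i = 0 → (v i : ℝ) = 0) →
      R + ∑ i, l i * ((v i : ℝ) - m i) ≤ M.totalTransfer v := by
  -- Zero means put `m` on the boundary of the attainable means. Ignoring those coordinates makes a
  -- whole neighbourhood of `m` admissible.
  set s : Set (Fin n) := {i | m i ≠ 0} with hs
  have hind : s.indicator m = m := by
    funext i
    by_cases hi : m i = 0 <;> simp [hs, hi]
  have hnear : ∀ᶠ z in 𝓝 m, ∀ y, vbar ≤ y → (z, y) ∈ M.revenueEpigraph s := by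
    have h1 : ∀ᶠ z : Fin n → ℝ in 𝓝 m, ∀ i, s.indicator z i ∈ Set.Icc 0 vbar := by
      refine eventually_all.mpr fun i => ?_
      by_cases hi : m i = 0
      · exact Eventually.of_forall fun z => by simp [hs, hi, hv]
      · have hi' : i ∈ s := hi
        simp only [Set.indicator_of_mem hi']
        exact (continuous_apply i).tendsto m |>.eventually
          (Icc_mem_nhds (lt_of_le_of_ne (hm i).1 (Ne.symm hi)) (hm i).2)
    filter_upwards [h1] with z hz y hy
    exact M.mem_revenueEpigraph (fun i => ⟨_, hz i⟩) (fun i => rfl)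
      ((hM.totalTransfer_le hv _).trans hy)
  obtain ⟨l, hl⟩ := (M.convex_revenueEpigraph s).exists_affine_le (R := R) hnear (by
    rintro y ⟨F, hF, hFi, hFy⟩
    simp only [hind] at hF
    have h2 : (R : EReal) ≤ M.expectedRevenue F := hR.trans (iInf₂_le F hF)
    rw [expectedRevenue_eq_integral M hFi] at h2
    exact (EReal.coe_le_coe_iff.mp h2).trans hFy)
  refine ⟨l, fun v hv0 => hl _ _ (M.mem_revenueEpigraph v (fun i => ?_) le_rfl)⟩
  by_cases hi : m i = 0
  · simp [hs, hi, hv0 i hi]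
  · simp [hs, hi]

/-! ### From affine minorants to scores. -/

/-- Raising negative slopes of an affine minorant of the revenue to `0` makes it a function that
is at most `0` or at most the modified score of some bidder. -/
theorem IsDSIC.affine_le_score {M : DirectMechanism n vbar} (hM : M.IsDSIC) (hir : M.IsExPostIR)
    (hv : 0 ≤ vbar) {N : Set (Fin n)} {c : ℝ} {l : Fin n → ℝ}
    (h : ∀ v : ValueProfile n vbar, (∀ i ∈ N, (v i : ℝ) = 0) →
      c + ∑ i, l i * (v i : ℝ) ≤ M.totalTransfer v) (hlN : ∀ i ∈ N, l i = 0)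
    (v : ValueProfile n vbar) :
    c + ∑ i, l i * (v i : ℝ) ≤ 0 ∨
      ∃ i, c + ∑ i, l i * (v i : ℝ) ≤ (1 + l i) * (v i : ℝ) - l i * vbar := by
  classical
  set v₀ : ValueProfile n vbar := fun i => if i ∈ N then ⟨0, le_rfl, hv⟩ else v i with hv₀
  have hv₀N : ∀ i ∈ N, (v₀ i : ℝ) = 0 := fun i hi => by simp [hv₀, hi]
  have hv₀N' : ∀ i, i ∉ N → v₀ i = v i := fun i hi => by simp [hv₀, hi]
  have hsum : ∑ i, l i * (v₀ i : ℝ) = ∑ i, l i * (v i : ℝ) := by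
    refine Finset.sum_congr rfl fun i _ => ?_
    by_cases hi : i ∈ N
    · simp [hlN i hi]
    · rw [hv₀N' i hi]
  rw [← hsum]
  by_cases hle : c + ∑ i, l i * (v₀ i : ℝ) ≤ 0
  · exact Or.inl hle
  right
  have hg := h v₀ hv₀N
  obtain ⟨i, hi⟩ := hir.exists_winner ((not_le.mp hle).trans_le hg)
  -- A winner in `N` has value `0` at `v₀`, so revenue could not be positive.
  have hiN : i ∉ N := by
    intro hiN
    have h1 := (hir.totalTransfer_le_winner hi).trans (hir.t_le_value hi)
    rw [hv₀N i hiN] at h1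
    exact hle (hg.trans h1)
  set w : Set.Icc (0 : ℝ) vbar := ⟨vbar, hv, le_rfl⟩ with hw
  have h1 := h (Function.update v₀ i w) fun j hj => by
    rw [Function.update_of_ne (ne_of_mem_of_not_mem hj hiN), hv₀N j hj]
  have h2 := hM.totalTransfer_update_top_le hir hi w (v₀ i).2.2
  have h3 : ∑ j, l j * ((Function.update v₀ i w j : Set.Icc (0 : ℝ) vbar) : ℝ)
      - ∑ j, l j * (v₀ j : ℝ) = l i * (vbar - (v₀ i : ℝ)) := by
    rw [← Finset.sum_sub_distrib, Finset.sum_eq_single i]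
    · rw [Function.update_self]; ring
    · intro j _ hj
      rw [Function.update_of_ne hj, sub_self]
    · simp
  refine ⟨i, ?_⟩
  rw [← hv₀N' i hiN]
  linarith

/-! ### The case of a mean equal to `vbar`. -/

/-- If one mean is `vbar`, that bidder can be charged `vbar` with certainty. -/
theorem exists_isCornerHittingLSA_of_mean_eq (hv : 0 < vbar) {m : Fin n → ℝ} {k : Fin n}
    (hk : m k = vbar) :
    ∃ A : DirectMechanism n vbar, A.IsCornerHittingLSA ∧ (vbar : EReal) ≤ A.revenueGuarantee m := by
  classical
  -- With `r i = vbar` for all `i`, no score exceeds `0`, so every sale is a tie at `0`; it is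
  -- resolved in favour of `k`.
  set α : Fin n → ℝ := fun _ => vbar with hα
  set β : Fin n → ℝ := fun _ => 1 with hβ
  set x : Fin n → ValueProfile n vbar → ℝ :=
    fun i v => if i = k ∧ (v k : ℝ) = vbar then 1 else 0 with hx
  have hmeas : ∀ i, Measurable (x i) := fun i =>
    Measurable.ite ((MeasurableSet.const _).inter (measurable_value k (measurableSet_singleton vbar)))
      measurable_const measurable_const
  have hdet : ∀ i v, x i v = 0 ∨ x i v = 1 := fun i v => by
    simp only [hx]
    split_ifs <;> simp
  have hsupply : ∀ v, ∑ i, x i v ≤ 1 := fun v => by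
    rw [Finset.sum_eq_single k (fun j _ hj => by simp [hx, hj]) (by simp)]
    rcases hdet k v with h | h <;> simp [h]
  have hscore : ∀ i (v : ValueProfile n vbar), linearScore α β v i ≤ 0 := fun i v => by
    simp only [linearScore, hα, hβ]
    linarith [(v i).2.2]
  have hbeat : ∀ i (v : ValueProfile n vbar), scoreToBeat α β v i = 0 := fun i v =>
    le_antisymm (scoreToBeat_le le_rfl fun j _ => hscore j v) (scoreToBeat_nonneg _ _ _ _)
  have hLSA := isLinearScoreAuction_ofScores (α := α) (β := β) hmeas hdet hsupply
    (fun _ => hv.le) (fun _ => one_pos)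
    (fun i v h => absurd h (by rw [hbeat]; exact not_lt.mpr (hscore i v)))
    (fun i v h => by
      refine if_neg ?_
      rintro ⟨rfl, hvi⟩
      rw [hbeat, linearScore, hvi] at h
      simp [hα, hβ] at h)
  refine ⟨ofScores α β x hmeas hdet hsupply, ⟨fun _ => vbar, fun _ => ⟨hv.le, le_rfl⟩, ?_⟩,
    le_iInf₂ fun F hF => ?_⟩
  · simpa using hLSA
  have := hF.1
  have hae : ∀ᵐ v ∂F, (v k : ℝ) = vbar := by
    have hnn : 0 ≤ᵐ[F] fun v : ValueProfile n vbar => vbar - (v k : ℝ) :=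
      ae_of_all _ fun v => sub_nonneg.mpr (v k).2.2
    have hint : Integrable (fun v : ValueProfile n vbar => vbar - (v k : ℝ)) F :=
      (integrable_const vbar).sub (integrable_value F k)
    have h0 : ∫ v : ValueProfile n vbar, (vbar - (v k : ℝ)) ∂F = 0 := by
      rw [integral_sub (integrable_const vbar) (integrable_value F k), hF.2 k, hk]
      simp
    filter_upwards [(integral_eq_zero_iff_of_nonneg_ae hnn hint).mp h0] with v h
    exact (sub_eq_zero.mp h).symm
  have hrev : (ofScores α β x hmeas hdet hsupply).totalTransfer =ᵐ[F] fun _ => vbar := by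
    filter_upwards [hae] with v h
    change ∑ i, x i v * ((scoreToBeat α β v i + α i) / β i) = vbar
    rw [Finset.sum_eq_single k (fun j _ hj => by simp [hx, hj]) (by simp)]
    rw [hbeat]
    simp [hx, h, hα, hβ]
  rw [expectedRevenue_eq_integral _ ((integrable_const vbar).congr hrev.symm),
    integral_congr_ae hrev]
  simp

end DirectMechanism

end

/-! ### The main theorem. -/

open DirectMechanism in
theorem theorem1 (n : ℕ) (hn : 2 ≤ n) (vbar : ℝ) (hvbar : 0 < vbar)
    (m : Fin n → ℝ) (hm : ∀ i, m i ∈ Set.Icc 0 vbar)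
    (M : DirectMechanism n vbar) (hdsic : M.IsDSIC) (hir : M.IsExPostIR) :
    ∃ A : DirectMechanism n vbar, A.IsCornerHittingLSA ∧
      M.revenueGuarantee m ≤ A.revenueGuarantee m := by
  have hle : M.revenueGuarantee m ≤ vbar := by
    refine (iInf₂_le (Measure.dirac fun i => ⟨m i, hm i⟩) ⟨inferInstance, fun i => ?_⟩).trans
      (hir.expectedRevenue_le hvbar.le _)
    rw [integral_dirac' _ _ (measurable_value i).stronglyMeasurable]
  by_cases hex : ∃ k, m k = vbar
  · obtain ⟨k, hk⟩ := hex
    obtain ⟨A, hA, hAm⟩ := exists_isCornerHittingLSA_of_mean_eq hvbar hk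
    exact ⟨A, hA, hle.trans hAm⟩
  push Not at hex
  by_cases hbot : M.revenueGuarantee m = ⊥
  · exact ⟨_, isCornerHittingLSA_topScoreAuction hvbar (l := 0) fun _ => le_rfl, by simp [hbot]⟩
  set R : ℝ := (M.revenueGuarantee m).toReal with hRdef
  have hR : (R : EReal) = M.revenueGuarantee m :=
    EReal.coe_toReal (hle.trans_lt (EReal.coe_lt_top _)).ne hbot
  obtain ⟨l, hl⟩ := hir.exists_affine_le
    (fun i => ⟨(hm i).1, lt_of_le_of_ne (hm i).2 (hex i)⟩) hvbar.le hR.le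
  -- Restricted to profiles that vanish on `N`, the minorant does not see the slopes in `N`, so they
  -- may be set to `0`.
  set N : Set (Fin n) := {i | m i = 0 ∨ l i < 0} with hN
  set l' : Fin n → ℝ := Nᶜ.indicator l with hl'
  have hl'N : ∀ i ∈ N, l' i = 0 := fun i hi => by simp [hl', hi]
  have hl'N' : ∀ i, i ∉ N → l' i = l i := fun i hi => by simp [hl', hi]
  have hl'0 : ∀ i, 0 ≤ l' i := by
    intro i
    by_cases hi : i ∈ N
    · exact (hl'N i hi).ge
    · rw [hl'N' i hi]
      exact not_lt.mp fun h => hi (Or.inr h)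
  set c : ℝ := R - ∑ i, l i * m i with hc
  have hkey := hdsic.affine_le_score hir hvbar.le (N := N) (c := c) (l := l') (fun v hv => by
    have h1 := hl v fun i hi => hv i (Or.inl hi)
    have h2 : ∑ i, l' i * (v i : ℝ) = ∑ i, l i * (v i : ℝ) := by
      refine Finset.sum_congr rfl fun i _ => ?_
      by_cases hi : i ∈ N
      · simp [hv i hi]
      · rw [hl'N' i hi]
    simp only [mul_sub, Finset.sum_sub_distrib] at h1
    rw [h2]
    linarith) hl'N
  have hLSA := isCornerHittingLSA_topScoreAuction hvbar hl'0
  refine ⟨_, hLSA, ?_⟩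
  obtain ⟨_, _, hA⟩ := hLSA
  refine le_trans ?_ (le_revenueGuarantee_of_affine_le hvbar.le hA.ir hl'0
    (affine_le_revenue_topScoreAuction hvbar hl'0 hkey))
  rw [← hR, EReal.coe_le_coe_iff]
  -- The change of slopes can only raise the value at `m`: it has no effect where `m i = 0` and
  -- removes a nonpositive term where `l i < 0`.
  have h3 : ∑ i, l i * m i ≤ ∑ i, l' i * m i := by
    refine Finset.sum_le_sum fun i _ => ?_
    by_cases hi : i ∈ N
    · rw [hl'N i hi, zero_mul]
      rcases hi with h0 | hneg
      · rw [h0, mul_zero]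
      · exact mul_nonpos_of_nonpos_of_nonneg hneg.le (hm i).1
    · rw [hl'N' i hi]
  linarith
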